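/- For an integer $\ell\ge 1$, $\lambda>0$ and $\underline h=(h_1,\dots,h_\ell)\in\mathbb R^\ell$ let $$Z_{\ell,\underline h}=\sum_{\sigma\in\{-1,1\}^{\{1,\dots,\ell\}}}\exp\Big(\sum_{i=1}^{\ell}\big\{\lambda\,\sigma(i)\sigma(i+1)+h_i\,\sigma(i)\big\}\Big),\qquad \sigma(\ell+1):=\sigma(1),$$ be the partition function of the one-dimensional periodic Ising chain with nearest-neighbour coupling $\lambda$ and site-dependent magnetic field $\underline h$. There is $\lambda_0>0$ such that for every $m_+\in(0,1)$ there is $h_+>0$, depending only on $m_+$, such that for every $\lambda\in(0,\lambda_0]$, every integer $\ell\ge 1$ and every $\underline m=(m_1,\dots,m_\ell)\in\mathbb R^\ell$ with $|m_i|\le m_+$ for all $i$, the following holds: there is a unique $\underline h\in\mathbb R^\ell$ such that $$m_i=\frac{\partial}{\partial h_i}\log Z_{\ell,\underline h}\qquad\text{for all } i=1,\dots,\ell,$$ and this $\underline h$ satisfies $|h_i|\le h_+$ for all $i=1,\dots,\ell$. -/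

import Mathlib

/-- The value `±1` of a spin as a real number; `ℤˣ = {1, -1}` is the set of spin values. -/
def spinVal (s : ℤˣ) : ℝ := ((s : ℤ) : ℝ)

/-- The partition function of the one-dimensional Ising chain with `ℓ` sites, periodic boundary
condition (`i + 1` is addition modulo `ℓ` in `Fin ℓ`, so the successor of the last site is the
first one), nearest-neighbour coupling `lam` and site-dependent field `h`:
`∑_σ exp (∑_i (lam σ(i) σ(i+1) + h_i σ(i)))`. -/
noncomputable def isingZ (ℓ : ℕ) [NeZero ℓ] (lam : ℝ) (h : Fin ℓ → ℝ) : ℝ :=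
  ∑ σ : Fin ℓ → ℤˣ,
    Real.exp (∑ i : Fin ℓ,
      (lam * spinVal (σ i) * spinVal (σ (i + 1)) + h i * spinVal (σ i)))

/-- `m_i = ∂ log Z_{ℓ,h} / ∂ h_i` for every site `i`: the partial derivative in the `i`-th field
component exists at `h` and equals `m i`. -/
def HasMagnetization (ℓ : ℕ) [NeZero ℓ] (lam : ℝ) (h m : Fin ℓ → ℝ) : Prop :=
  ∀ i : Fin ℓ,
    HasDerivAt (fun t : ℝ => Real.log (isingZ ℓ lam (Function.update h i t))) (m i) (h i)

/-! Centring the spins at `m` turns the equations into criticality of F(h) = exp(-h·m) Z(h)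
(`hasMagnetization_iff`). As |m i| ≤ M < 1, some configuration aligned with h makes F coercive, so a
minimiser exists; monotonicity of exp gives uniqueness. The field bound is local: reversing spin i
changes the interaction by at most 4λ whatever ℓ is, so too large a field would bias that spin
beyond m i in every environment (`abs_field_le`). -/

lemma spinVal_eq_one_or (s : ℤˣ) : spinVal s = 1 ∨ spinVal s = -1 := by
  rcases Int.units_eq_one_or s with rfl | rfl <;> simp [spinVal]

lemma spinVal_neg (s : ℤˣ) : spinVal (-s) = -spinVal s := by
  simp [spinVal]

lemma abs_spinVal (s : ℤˣ) : |spinVal s| = 1 := by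
  rcases spinVal_eq_one_or s with h | h <;> simp [h]

lemma one_add_mul_exp_lt {μ M a b : ℝ} (hM : M < 1) (hμ : |μ| ≤ M)
    (hab : Real.log ((1 + M) / (1 - M)) < a - b) :
    (1 + μ) * Real.exp b < (1 - μ) * Real.exp a := by
  have hμ' := abs_le.1 hμ
  have hM0 : 0 ≤ M := (abs_nonneg _).trans hμ
  have h1 : (0 : ℝ) < 1 - M := sub_pos.2 hM
  rw [Real.log_lt_iff_lt_exp (by positivity), Real.exp_sub, div_lt_div_iff₀ h1 (Real.exp_pos _)]
    at hab
  calc (1 + μ) * Real.exp b ≤ (1 + M) * Real.exp b := by gcongr; exact hμ'.2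
    _ < Real.exp a * (1 - M) := hab
    _ ≤ (1 - μ) * Real.exp a := by
      rw [mul_comm]
      gcongr
      exact hμ'.2

/-- A spin `x` in a field exceeding the threshold has magnetization above `μ`. -/
lemma two_point_pos {x μ M H c a b : ℝ} (hx : x = 1 ∨ x = -1) (hM : M < 1) (hμ : |μ| ≤ M)
    (hab : |a - b - 2 * (H * x)| ≤ c)
    (hH : Real.log ((1 + M) / (1 - M)) + c < 2 * H) :
    0 < (x - μ) * Real.exp a + (-x - μ) * Real.exp b := by
  have hab' := abs_le.1 hab
  rcases hx with rfl | rfl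
  · linarith [one_add_mul_exp_lt (a := a) (b := b) hM hμ (by linarith)]
  · linarith [one_add_mul_exp_lt (a := b) (b := a) hM hμ (by linarith)]

section
variable {ℓ : ℕ}

lemma hasDerivAt_sum_update_mul (h a : Fin ℓ → ℝ) (i : Fin ℓ) :
    HasDerivAt (fun t => ∑ j, Function.update h i t j * a j) (a i) (h i) := by
  have key : ∀ t, ∑ j, Function.update h i t j * a j
      = t * a i + ∑ j ∈ Finset.univ.erase i, h j * a j := by
    intro t
    rw [← Finset.add_sum_erase _ _ (Finset.mem_univ i)]
    congr 1
    · simp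
    · exact Finset.sum_congr rfl fun j hj => by simp [Finset.ne_of_mem_erase hj]
  simp_rw [key]
  exact (hasDerivAt_mul_const (a i)).add_const _

/-- Aligning each spin with `d` makes the centred linear form large. -/
lemma exists_config_le (d m : Fin ℓ → ℝ) {M : ℝ} (hm : ∀ i, |m i| ≤ M) :
    ∃ σ : Fin ℓ → ℤˣ, (1 - M) * ∑ i, |d i| ≤ ∑ i, d i * (spinVal (σ i) - m i) := by
  refine ⟨fun i => if 0 ≤ d i then 1 else -1, ?_⟩
  rw [Finset.mul_sum]
  refine Finset.sum_le_sum fun i _ => ?_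
  have := abs_le.1 (hm i)
  by_cases hd : 0 ≤ d i
  · simp only [hd, if_true, abs_of_nonneg hd, spinVal]
    push_cast
    nlinarith
  · simp only [hd, if_false, abs_of_neg (not_le.1 hd), spinVal]
    push_cast
    nlinarith [not_le.1 hd]

lemma norm_le_sum_abs (d : Fin ℓ → ℝ) : ‖d‖ ≤ ∑ i, |d i| :=
  (pi_norm_le_iff_of_nonneg (Finset.sum_nonneg fun _ _ => abs_nonneg _)).2 fun i =>
    Finset.single_le_sum (f := fun j => |d j|) (fun _ _ => abs_nonneg _) (Finset.mem_univ i)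

/-- The configuration with the spin at `i` reversed. -/
def flipSpin (i : Fin ℓ) (σ : Fin ℓ → ℤˣ) : Fin ℓ → ℤˣ := Function.update σ i (-σ i)

lemma flipSpin_involutive (i : Fin ℓ) : Function.Involutive (flipSpin i) := fun σ => by
  simp [flipSpin]

lemma sum_flipSpin (i : Fin ℓ) (f : (Fin ℓ → ℤˣ) → ℝ) : ∑ σ, f (flipSpin i σ) = ∑ σ, f σ :=
  Equiv.sum_comp (flipSpin_involutive i).toPerm f

lemma sum_field_flipSpin (m h : Fin ℓ → ℝ) (i : Fin ℓ) (σ : Fin ℓ → ℤˣ) :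
    ∑ j, h j * (spinVal (flipSpin i σ j) - m j) =
      ∑ j, h j * (spinVal (σ j) - m j) - 2 * (h i * spinVal (σ i)) := by
  rw [← Finset.add_sum_erase _ _ (Finset.mem_univ i),
    ← Finset.add_sum_erase (a := i) _ (fun j => h j * (spinVal (σ j) - m j)) (Finset.mem_univ i),
    Finset.sum_congr rfl fun j hj => by
      rw [flipSpin, Function.update_of_ne (Finset.ne_of_mem_erase hj)]]
  simp only [flipSpin, Function.update_self, spinVal_neg]
  ring

end

/-- The nearest-neighbour interaction energy of a configuration on the periodic chain. -/
noncomputable def isingInteraction (ℓ : ℕ) [NeZero ℓ] (lam : ℝ) (σ : Fin ℓ → ℤˣ) : ℝ :=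
  ∑ i : Fin ℓ, lam * spinVal (σ i) * spinVal (σ (i + 1))

/-- The unnormalised Gibbs weight of a configuration, with spins centred at `m`. -/
noncomputable def centredWeight (ℓ : ℕ) [NeZero ℓ] (lam : ℝ) (m h : Fin ℓ → ℝ)
    (σ : Fin ℓ → ℤˣ) : ℝ :=
  Real.exp (isingInteraction ℓ lam σ + ∑ i, h i * (spinVal (σ i) - m i))

section
variable {ℓ : ℕ} [NeZero ℓ] {lam : ℝ}

lemma exp_energy_eq (m h : Fin ℓ → ℝ) (σ : Fin ℓ → ℤˣ) :
    Real.exp (∑ i : Fin ℓ,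
        (lam * spinVal (σ i) * spinVal (σ (i + 1)) + h i * spinVal (σ i))) =
      Real.exp (∑ i, h i * m i) * centredWeight ℓ lam m h σ := by
  rw [centredWeight, isingInteraction, ← Real.exp_add, ← Finset.sum_add_distrib,
    ← Finset.sum_add_distrib]
  congr 1
  exact Finset.sum_congr rfl fun i _ => by ring

lemma hasDerivAt_sum_centredWeight (m h : Fin ℓ → ℝ) (i : Fin ℓ) :
    HasDerivAt (fun t => ∑ σ, centredWeight ℓ lam m (Function.update h i t) σ)
      (∑ σ, (spinVal (σ i) - m i) * centredWeight ℓ lam m h σ) (h i) := by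
  refine HasDerivAt.fun_sum fun σ _ => ?_
  have := ((hasDerivAt_sum_update_mul h (fun j => spinVal (σ j) - m j) i).const_add
    (isingInteraction ℓ lam σ)).exp
  simpa [centredWeight, mul_comm] using this

lemma isingZ_eq (m h : Fin ℓ → ℝ) :
    isingZ ℓ lam h = Real.exp (∑ i, h i * m i) * ∑ σ, centredWeight ℓ lam m h σ := by
  rw [isingZ, Finset.mul_sum]
  exact Finset.sum_congr rfl fun σ _ => exp_energy_eq m h σ

lemma sum_centredWeight_pos (m h : Fin ℓ → ℝ) : 0 < ∑ σ, centredWeight ℓ lam m h σ :=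
  Finset.sum_pos (fun _ _ => Real.exp_pos _) Finset.univ_nonempty

lemma hasDerivAt_log_isingZ (m h : Fin ℓ → ℝ) (i : Fin ℓ) :
    HasDerivAt (fun t => Real.log (isingZ ℓ lam (Function.update h i t)))
      (m i + (∑ σ, (spinVal (σ i) - m i) * centredWeight ℓ lam m h σ) /
        ∑ σ, centredWeight ℓ lam m h σ) (h i) := by
  have key : ∀ t, Real.log (isingZ ℓ lam (Function.update h i t)) =
      ∑ j, Function.update h i t j * m j +
        Real.log (∑ σ, centredWeight ℓ lam m (Function.update h i t) σ) := fun t => by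
    rw [isingZ_eq m, Real.log_mul (Real.exp_ne_zero _) (sum_centredWeight_pos _ _).ne',
      Real.log_exp]
  simp_rw [key]
  have := (hasDerivAt_sum_update_mul h m i).add
    ((hasDerivAt_sum_centredWeight (lam := lam) m h i).log (sum_centredWeight_pos _ _).ne')
  simp only [Function.update_eq_self] at this
  exact this

lemma hasMagnetization_iff (m h : Fin ℓ → ℝ) :
    HasMagnetization ℓ lam h m ↔
      ∀ i, ∑ σ, (spinVal (σ i) - m i) * centredWeight ℓ lam m h σ = 0 := by
  refine forall_congr' fun i => ⟨fun H => ?_, fun H => ?_⟩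
  · have := H.unique (hasDerivAt_log_isingZ m h i)
    simpa [(sum_centredWeight_pos (lam := lam) m h).ne'] using this
  · simpa [H] using hasDerivAt_log_isingZ (lam := lam) m h i

lemma tendsto_sum_centredWeight (m : Fin ℓ → ℝ) {M : ℝ} (hM : M < 1) (hm : ∀ i, |m i| ≤ M) :
    Filter.Tendsto (fun h => ∑ σ, centredWeight ℓ lam m h σ)
      (Filter.cocompact (Fin ℓ → ℝ)) Filter.atTop := by
  -- The aligned configuration varies with h; the minimal interaction bounds its energy uniformly.
  obtain ⟨σ₀, hσ₀⟩ := Finite.exists_min (isingInteraction ℓ lam)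
  have lower : ∀ h : Fin ℓ → ℝ, isingInteraction ℓ lam σ₀ + (1 - M) * ‖h‖ ≤
      ∑ σ, centredWeight ℓ lam m h σ := by
    intro h
    obtain ⟨σ, hσ⟩ := exists_config_le h m hm
    have h1 := mul_le_mul_of_nonneg_left (norm_le_sum_abs h) (sub_pos.2 hM).le
    calc _ ≤ isingInteraction ℓ lam σ + ∑ i, h i * (spinVal (σ i) - m i) := by
          linarith [hσ₀ σ]
      _ ≤ centredWeight ℓ lam m h σ :=
          (by linarith : _ ≤ _ + (1 : ℝ)).trans (Real.add_one_le_exp _)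
      _ ≤ _ := Finset.single_le_sum (f := fun σ => centredWeight ℓ lam m h σ)
          (fun _ _ => (Real.exp_pos _).le) (Finset.mem_univ σ)
  refine Filter.tendsto_atTop_mono lower (Filter.tendsto_atTop_add_const_left _ _ ?_)
  exact (tendsto_norm_cocompact_atTop (E := Fin ℓ → ℝ)).const_mul_atTop (sub_pos.2 hM)

lemma exists_hasMagnetization (m : Fin ℓ → ℝ) {M : ℝ} (hM : M < 1) (hm : ∀ i, |m i| ≤ M) :
    ∃ h, HasMagnetization ℓ lam h m := by
  have hcont : Continuous fun h => ∑ σ, centredWeight ℓ lam m h σ := by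
    unfold centredWeight
    fun_prop
  obtain ⟨h, hmin⟩ := hcont.exists_forall_le (tendsto_sum_centredWeight m hM hm)
  refine ⟨h, (hasMagnetization_iff m h).2 fun i => ?_⟩
  refine IsLocalMin.hasDerivAt_eq_zero (Filter.Eventually.of_forall fun t => ?_)
    (hasDerivAt_sum_centredWeight m h i)
  simpa using hmin (Function.update h i t)

/-- Pair the difference of the two gradients with h' - h: each configuration contributes a term (u -
v)(exp u - exp v) ≥ 0 up to a positive factor, so all vanish. The one aligned with h' - h then
forces h' = h. -/
lemma hasMagnetization_unique (m : Fin ℓ → ℝ) {M : ℝ} (hM : M < 1) (hm : ∀ i, |m i| ≤ M)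
    {h h' : Fin ℓ → ℝ} (H : HasMagnetization ℓ lam h m) (H' : HasMagnetization ℓ lam h' m) :
    h' = h := by
  rw [hasMagnetization_iff] at H H'
  have lin : ∀ σ : Fin ℓ → ℤˣ, ∑ i, (h' - h) i * (spinVal (σ i) - m i) =
      (∑ i, h' i * (spinVal (σ i) - m i)) - ∑ i, h i * (spinVal (σ i) - m i) := by
    intro σ
    rw [← Finset.sum_sub_distrib]
    exact Finset.sum_congr rfl fun i _ => by rw [Pi.sub_apply]; ring
  have hsum : ∑ σ, (∑ i, (h' - h) i * (spinVal (σ i) - m i)) *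
      (centredWeight ℓ lam m h' σ - centredWeight ℓ lam m h σ) = 0 := by
    simp_rw [Finset.sum_mul]
    rw [Finset.sum_comm]
    refine Finset.sum_eq_zero fun i _ => ?_
    have : ∀ σ : Fin ℓ → ℤˣ, (h' - h) i * (spinVal (σ i) - m i) *
        (centredWeight ℓ lam m h' σ - centredWeight ℓ lam m h σ) =
        (h' - h) i * ((spinVal (σ i) - m i) * centredWeight ℓ lam m h' σ) -
          (h' - h) i * ((spinVal (σ i) - m i) * centredWeight ℓ lam m h σ) := fun σ => by ring
    simp_rw [this]
    rw [Finset.sum_sub_distrib, ← Finset.mul_sum, ← Finset.mul_sum, H i, H' i]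
    simp
  have hnn : ∀ σ ∈ (Finset.univ : Finset (Fin ℓ → ℤˣ)),
      0 ≤ (∑ i, (h' - h) i * (spinVal (σ i) - m i)) *
        (centredWeight ℓ lam m h' σ - centredWeight ℓ lam m h σ) := by
    intro σ _
    rw [lin σ, centredWeight, centredWeight]
    rcases le_total (∑ i, h i * (spinVal (σ i) - m i)) (∑ i, h' i * (spinVal (σ i) - m i))
      with hle | hle
    · exact mul_nonneg (sub_nonneg.2 hle) (sub_nonneg.2 (Real.exp_le_exp.2 (by linarith)))
    · exact mul_nonneg_of_nonpos_of_nonpos (sub_nonpos.2 hle)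
        (sub_nonpos.2 (Real.exp_le_exp.2 (by linarith)))
  obtain ⟨σ, hσ⟩ := exists_config_le (h' - h) m hm
  have hzero : ∑ i, (h' - h) i * (spinVal (σ i) - m i) = 0 := by
    rcases mul_eq_zero.1 ((Finset.sum_eq_zero_iff_of_nonneg hnn).1 hsum σ (Finset.mem_univ σ))
      with h0 | h0
    · exact h0
    · rw [centredWeight, centredWeight, sub_eq_zero, Real.exp_eq_exp] at h0
      rw [lin σ]
      linarith
  have hnorm : ‖h' - h‖ ≤ 0 := by
    have h1 := norm_le_sum_abs (h' - h)
    have h2 : ∑ i, |(h' - h) i| ≤ 0 :=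
      nonpos_of_mul_nonpos_right (hσ.trans hzero.le) (sub_pos.2 hM)
    exact h1.trans h2
  exact sub_eq_zero.1 (norm_le_zero_iff.1 hnorm)

lemma abs_isingInteraction_sub_flipSpin_le (hlam : 0 ≤ lam) (i : Fin ℓ) (σ : Fin ℓ → ℤˣ) :
    |isingInteraction ℓ lam σ - isingInteraction ℓ lam (flipSpin i σ)| ≤ 4 * lam := by
  rw [isingInteraction, isingInteraction, ← Finset.sum_sub_distrib]
  have term : ∀ j ∈ (Finset.univ : Finset (Fin ℓ)),
      |lam * spinVal (σ j) * spinVal (σ (j + 1)) -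
        lam * spinVal (flipSpin i σ j) * spinVal (flipSpin i σ (j + 1))| ≤
      -- Only the two bonds at i change. Adding the indicators also covers ℓ = 1, where i - 1 = i.
      (if j = i then 2 * lam else 0) + (if j = i - 1 then 2 * lam else 0) := by
    intro j _
    have bound : |lam * spinVal (σ j) * spinVal (σ (j + 1)) -
        lam * spinVal (flipSpin i σ j) * spinVal (flipSpin i σ (j + 1))| ≤ 2 * lam := by
      refine (abs_sub _ _).trans ?_
      simp only [abs_mul, abs_spinVal, abs_of_nonneg hlam]
      linarith
    by_cases h1 : j = i
    · rw [if_pos h1]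
      split_ifs <;> linarith
    · by_cases h2 : j = i - 1
      · rw [if_neg h1, if_pos h2]
        linarith
      · have h3 : j + 1 ≠ i := fun h => h2 (eq_sub_of_add_eq h)
        simp [flipSpin, h1, h2, h3]
  refine (Finset.abs_sum_le_sum_abs _ _).trans ((Finset.sum_le_sum term).trans ?_)
  rw [Finset.sum_add_distrib]
  simp only [Finset.sum_ite_eq', Finset.mem_univ, if_true]
  linarith

/-- Pairing σ with its flip at i writes twice the vanishing derivative as a sum of two-point terms,
which all share a strict sign if the bound fails. -/
lemma abs_field_le (hlam : 0 ≤ lam) {m h : Fin ℓ → ℝ} {M : ℝ} (hM : M < 1)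
    (hm : ∀ i, |m i| ≤ M) (H : HasMagnetization ℓ lam h m) (i : Fin ℓ) :
    |h i| ≤ Real.log ((1 + M) / (1 - M)) / 2 + 2 * lam := by
  have hsum : ∑ σ, ((spinVal (σ i) - m i) * centredWeight ℓ lam m h σ +
      (-spinVal (σ i) - m i) * centredWeight ℓ lam m h (flipSpin i σ)) = 0 := by
    have h0 := (hasMagnetization_iff m h).1 H i
    have h1 := sum_flipSpin i fun σ => (spinVal (σ i) - m i) * centredWeight ℓ lam m h σ
    simp only [flipSpin, Function.update_self, spinVal_neg] at h1
    rw [Finset.sum_add_distrib, h0, zero_add]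
    exact h1.trans h0
  have hdiff : ∀ σ : Fin ℓ → ℤˣ,
      |(isingInteraction ℓ lam σ + ∑ j, h j * (spinVal (σ j) - m j)) -
        (isingInteraction ℓ lam (flipSpin i σ) +
          ∑ j, h j * (spinVal (flipSpin i σ j) - m j)) - 2 * (h i * spinVal (σ i))| ≤
        4 * lam := fun σ => by
    rw [sum_field_flipSpin]
    convert abs_isingInteraction_sub_flipSpin_le hlam i σ using 2
    ring
  refine abs_le.2 ⟨?_, ?_⟩
  · by_contra! hlt
    have : 0 < ∑ σ, -((spinVal (σ i) - m i) * centredWeight ℓ lam m h σ +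
        (-spinVal (σ i) - m i) * centredWeight ℓ lam m h (flipSpin i σ)) := by
      refine Finset.sum_pos (fun σ _ => ?_) Finset.univ_nonempty
      -- Spin-reversal symmetry reduces a very negative field to the positive case.
      have := two_point_pos (x := -spinVal (σ i)) (μ := -m i) (H := -h i)
        ((spinVal_eq_one_or (σ i)).symm.imp (fun e => by rw [e, neg_neg]) (fun e => by rw [e]))
        hM ((abs_neg _).trans_le (hm i)) ((neg_mul_neg (h i) _).symm ▸ hdiff σ) (by linarith)
      rw [centredWeight, centredWeight]
      linarith
    rw [Finset.sum_neg_distrib, hsum] at this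
    simp at this
  · by_contra! hlt
    exact (Finset.sum_pos (fun σ _ => two_point_pos (spinVal_eq_one_or (σ i)) hM (hm i)
      (hdiff σ) (by linarith)) Finset.univ_nonempty).ne' hsum

end

theorem mainTheorem8 :
    ∃ lam₀ : ℝ, 0 < lam₀ ∧
      ∀ mplus : ℝ, 0 < mplus → mplus < 1 →
        ∃ hplus : ℝ, 0 < hplus ∧
          ∀ lam : ℝ, 0 < lam → lam ≤ lam₀ →
            ∀ (ℓ : ℕ) [NeZero ℓ] (m : Fin ℓ → ℝ), (∀ i, |m i| ≤ mplus) →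
              (∃! h : Fin ℓ → ℝ, HasMagnetization ℓ lam h m) ∧
              ∀ h : Fin ℓ → ℝ, HasMagnetization ℓ lam h m → ∀ i, |h i| ≤ hplus := by
  -- The value 1 is arbitrary: it only bounds 2λ by 2, freeing the field bound of λ.
  refine ⟨1, one_pos, fun M hM0 hM1 =>
    ⟨Real.log ((1 + M) / (1 - M)) / 2 + 2, ?_, fun lam hlam hlam1 ℓ _ m hm => ⟨?_, ?_⟩⟩⟩
  · have : 0 ≤ Real.log ((1 + M) / (1 - M)) :=
      Real.log_nonneg ((one_le_div (sub_pos.2 hM1)).2 (by linarith))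
    linarith
  · obtain ⟨h, H⟩ := exists_hasMagnetization (lam := lam) m hM1 hm
    exact ⟨h, H, fun h' H' => hasMagnetization_unique m hM1 hm H H'⟩
  · intro h H i
    linarith [abs_field_le hlam.le hM1 hm H i]
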